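/- Let $\mathbb{R}^d$ and $\mathbb{R}^m$ be equipped with arbitrary norms, both denoted $\|\cdot\|$, and let $\mathrm{dist}(x,Q)=\inf_{y\in Q}\|x-y\|$. A set is polyhedral if it is the intersection of finitely many closed half-spaces. A map $\mathbb{R}^d\to\mathbb{R}^k$ is piecewise affine if $\mathbb{R}^d$ is a union of finitely many polyhedral sets with nonempty, pairwise disjoint interiors, on each of which the map coincides with an affine map. For $Q\subseteq\mathbb{R}^d$ let $0^+Q$ be the set of all $z$ for which there is $x\in Q$ with $x+\lambda z\in Q$ for all $\lambda\ge 0$. A cone is a (not necessarily convex) set closed under multiplication by positive scalars, $\mathrm{cone}\,V$ is the smallest cone containing $V$, and $\mathrm{cl}$ denotes closure. A function $g:\mathbb{R}^d\to\mathbb{R}$ is coercive on $V$ if $g(x_k)\to+\infty$ for every sequence $\{x_k\}\subset V$ with $\|x_k\|\to+\infty$. Put $S(g)=\{x : g(x)\le 0\}$ and $g^\infty(x)=\lim_{\lambda\to+\infty} g(\lambda x)/\lambda$. **Theorem.** Let $F:\mathbb{R}^d\to\mathbb{R}^m$ and $G=(G_1,\dots,G_n):\mathbb{R}^d\to\mathbb{R}^n$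 be piecewise affine, suppose that $\Omega=\{x\in\mathbb{R}^d : F(x)=0,\ G_i(x)\le 0,\ i=1,\dots,n\}$ is nonempty, put $$\varphi(x)=\|F(x)\|+\sum_{i=1}^n\max\{G_i(x),0\},$$ and let $V\subseteq\mathbb{R}^d$ be any set. Then the limit $\varphi^\infty(x)$ exists for every $x\in\mathbb{R}^d$. There exists $\tau>0$ such that $$\tau\,\mathrm{dist}(x,\Omega)\le\varphi(x)\qquad\forall x\in V, \tag{$*$}$$ provided one of the following five conditions holds: 1. $V$ is bounded; 2. $V$ is unbounded and $\liminf_{\|x\|\to+\infty,\ x\in V}\varphi(x)/\|x\|>0$; 3. $V$ is a cone and $\varphi$ is coercive on $V$; 4. $V=\mathbb{R}^d$ and both $F$ and $G$ are positively homogeneous; 5. $V$ is a finite union of polyhedral sets and $S(\varphi^\infty)\cap 0^+V\subseteq 0^+\Omega$. Conversely, let $(*)$ hold for some $\tau>0$ (with $V$ an arbitrary set). Then $S(\varphi^\infty)\cap 0^+V\subseteq 0^+\Omega$. If, moreover, $0^+\Omega\cap\mathrm{cl}\,\mathrm{cone}\,V=\{0\}$, then $\varphi$ is coercive on $V$ and,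 when $V$ is unbounded, $\liminf_{\|x\|\to+\infty,\ x\in V}\varphi(x)/\|x\|>0$. -/

import Mathlib

open Filter Topology

namespace PAErrorBound

section Geometry

variable {E : Type*} [AddCommGroup E] [Module ℝ E]

/-- A polyhedral set: the intersection of finitely many closed half-spaces, that is, the solution
set of a finite system of linear inequalities. -/
def IsPolyhedral (Q : Set E) : Prop :=
  ∃ (k : ℕ) (a : Fin k → (E →ₗ[ℝ] ℝ)) (b : Fin k → ℝ), Q = {x | ∀ i, a i x ≤ b i}

/-- A finite union of polyhedral sets. -/
def IsFiniteUnionPolyhedral (V : Set E) : Prop :=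
  ∃ (k : ℕ) (Q : Fin k → Set E), (∀ i, IsPolyhedral (Q i)) ∧ V = ⋃ i, Q i

/-- The recession cone `0⁺ Q`: all `z` such that some ray `x + t z`, `t ≥ 0`, lies in `Q`. -/
def recessionCone (Q : Set E) : Set E :=
  {z | ∃ x ∈ Q, ∀ t : ℝ, 0 ≤ t → x + t • z ∈ Q}

/-- A cone (not necessarily convex): a set closed under multiplication by positive scalars. -/
def IsCone (K : Set E) : Prop :=
  ∀ x ∈ K, ∀ t : ℝ, 0 < t → t • x ∈ K

/-- The conic hull of `V`, i.e. the smallest cone containing `V`. -/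
def conicHull (V : Set E) : Set E :=
  {y | ∃ x ∈ V, ∃ t : ℝ, 0 < t ∧ y = t • x}

/-- Positive homogeneity of a map between real vector spaces. -/
def IsPosHomogeneous {H : Type*} [AddCommGroup H] [Module ℝ H] (F : E → H) : Prop :=
  ∀ (x : E) (t : ℝ), 0 < t → F (t • x) = t • F x

/-- The lower `0`-level set `S(g)`. -/
def lowerLevelSet (g : E → ℝ) : Set E := {x | g x ≤ 0}

/-- The recession function `g^∞(x) = lim_{t → +∞} g(t x) / t`. -/
noncomputable def recessionFunction (g : E → ℝ) (x : E) : ℝ :=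
  limUnder atTop (fun t : ℝ => g (t • x) / t)

end Geometry

section Analysis

variable {E : Type*} [NormedAddCommGroup E] [NormedSpace ℝ E]

/-- The sets `Q 1, …, Q s` form a polyhedral partition of the space. -/
def IsPolyhedralPartition {s : ℕ} (Q : Fin s → Set E) : Prop :=
  (∀ i, IsPolyhedral (Q i)) ∧ (⋃ i, Q i) = Set.univ ∧ (∀ i, (interior (Q i)).Nonempty) ∧
    ∀ i j, i ≠ j → interior (Q i) ∩ interior (Q j) = ∅

/-- `F` is piecewise affine: it coincides with an affine map on each member of some polyhedral
partition of the space. -/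
def IsPiecewiseAffine {H : Type*} [AddCommGroup H] [Module ℝ H] (F : E → H) : Prop :=
  ∃ (s : ℕ) (Q : Fin s → Set E) (A : Fin s → (E →ᵃ[ℝ] H)),
    IsPolyhedralPartition Q ∧ ∀ i, ∀ x ∈ Q i, F x = A i x

/-- `g` is coercive on `V`. -/
def IsCoerciveOn (g : E → ℝ) (V : Set E) : Prop :=
  ∀ u : ℕ → E, (∀ k, u k ∈ V) → Tendsto (fun k => ‖u k‖) atTop atTop →
    Tendsto (fun k => g (u k)) atTop atTop

/-- The lower limit of `g x / ‖x‖` as `‖x‖ → +∞` with `x ∈ V`, as an extended real number. -/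
noncomputable def growthAtInfinity (g : E → ℝ) (V : Set E) : EReal :=
  liminf (fun x => ((g x / ‖x‖ : ℝ) : EReal)) (comap (fun x : E => ‖x‖) atTop ⊓ 𝓟 V)

variable {H : Type*} [NormedAddCommGroup H] [NormedSpace ℝ H] {n : ℕ}

/-- The solution set `Ω` of the system `F x = 0`, `G x ≤ 0` (coordinate-wise). -/
def solutionSet (F : E → H) (G : E → Fin n → ℝ) : Set E :=
  {x | F x = 0 ∧ ∀ i, G x i ≤ 0}

/-- The residual `φ(x) = ‖F x‖ + ∑ᵢ max {Gᵢ x, 0}` of the system. -/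
noncomputable def systemResidual (F : E → H) (G : E → Fin n → ℝ) (x : E) : ℝ :=
  ‖F x‖ + ∑ i, max (G x i) 0

/-- The error bound `τ dist(x, Ω) ≤ φ(x)` holds for all `x ∈ V` with some `τ > 0`. -/
def HasErrorBoundOn (F : E → H) (G : E → Fin n → ℝ) (V : Set E) : Prop :=
  ∃ τ : ℝ, 0 < τ ∧ ∀ x ∈ V, τ * Metric.infDist x (solutionSet F G) ≤ systemResidual F G x

end Analysis

end PAErrorBound

open PAErrorBound

/-! Finitely many polyhedral pieces cover the space, with `F` and `G` affine on each. Hoffman's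
bound, proved by Fourier–Motzkin elimination, gives on each piece either a linear bound of the
distance to `Ω` by `φ` or, if the piece contains no solution, a positive lower bound of `φ`. So the
error bound always holds where `φ` is small (`eventually_infDist_le`), and on `V` only the coarse
estimate `dist(x, Ω) ≤ C (1 + φ(x))` is needed (`hasErrorBoundOn_of_infDist_le`).

Linear growth of `φ` on `V` yields this estimate at once, which settles conditions 1 and 2.
Condition 3 reduces to linear growth because `φ(t x) ≤ t φ(x) + C` for `0 ≤ t ≤ 1`; condition 4
reduces to the unit ball by scaling. Under condition 5, Hoffman's bound for the homogenised system
places `x` within a multiple of `1 + φ(x)` of a direction in `S(φ^∞) ∩ 0⁺V`, hence in `0⁺Ω`, and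
`0⁺Ω` lies within bounded distance of `Ω`.

Conversely, a ray in `V` with `φ^∞ = 0` has bounded residual, so it stays near `Ω`, and its
direction recedes in `Ω`. If linear growth fails, normalised points of `V` accumulate at a unit
vector of `0⁺Ω ∩ cl cone V`. Both use `mem_recessionCone_solutionSet_of_tendsto`. -/

namespace PAErrorBound

/-! ### Hoffman's bound by elimination of variables -/

/-- For the finite system `a i x ≤ b i`, either every approximate solution is close to a solution,
linearly in the violation (Hoffman's bound), or the violation is bounded away from zero. -/
def HoffmanAlternative {E : Type*} [NormedAddCommGroup E] [NormedSpace ℝ E] {ι : Type}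
    (a : ι → E →ₗ[ℝ] ℝ) (b : ι → ℝ) : Prop :=
  (∃ C, 0 ≤ C ∧ ∀ x r, 0 ≤ r → (∀ i, a i x ≤ b i + r) →
    ∃ y, (∀ i, a i y ≤ b i) ∧ ‖x - y‖ ≤ C * r) ∨
  ∃ ε, 0 < ε ∧ ∀ x r, 0 ≤ r → (∀ i, a i x ≤ b i + r) → ε ≤ r

theorem exists_between_near {ι : Type} [Fintype ι] {p q : ι → Prop} {l u : ι → ℝ} {s δ : ℝ}
    (hδ : 0 ≤ δ) (hlu : ∀ i j, p i → q j → l i ≤ u j) (hl : ∀ i, p i → l i - δ ≤ s)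
    (hu : ∀ j, q j → s ≤ u j + δ) :
    ∃ s', (∀ i, p i → l i ≤ s') ∧ (∀ j, q j → s' ≤ u j) ∧ |s - s'| ≤ δ := by
  classical
  -- The maximum of `s - δ` and the lower bounds will serve as `s'`; inserting `s - δ` keeps the set
  -- nonempty and prevents `s'` from falling too far below `s`.
  let T : Finset ℝ := insert (s - δ) ((Finset.univ.filter p).image l)
  have hT : T.Nonempty := Finset.insert_nonempty _ _
  have hmax := T.max'_mem hT
  have h1 : s - δ ≤ T.max' hT := T.le_max' _ (Finset.mem_insert_self _ _)
  refine ⟨T.max' hT, fun i hi => T.le_max' _ ?_, fun j hj => ?_, ?_⟩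
  · exact Finset.mem_insert_of_mem (Finset.mem_image_of_mem _ (by simpa using hi))
  · rcases Finset.mem_insert.1 hmax with h | h
    · rw [h]; linarith [hu j hj]
    · obtain ⟨i, hi, h⟩ := Finset.mem_image.1 h
      rw [← h]; exact hlu i j (by simpa using hi) hj
  · rw [abs_le]
    refine ⟨?_, by linarith⟩
    rcases Finset.mem_insert.1 hmax with h | h
    · rw [h]; linarith
    · obtain ⟨i, hi, h⟩ := Finset.mem_image.1 h
      rw [← h]; linarith [hl i (by simpa using hi)]

/-- One step of Fourier–Motzkin elimination. -/
theorem HoffmanAlternative.prod {E : Type*} [NormedAddCommGroup E] [NormedSpace ℝ E]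
    [FiniteDimensional ℝ E]
    (hE : ∀ {κ : Type} [Fintype κ] (a : κ → E →ₗ[ℝ] ℝ) (b : κ → ℝ), HoffmanAlternative a b)
    {ι : Type} [Fintype ι] (a : ι → (E × ℝ) →ₗ[ℝ] ℝ) (b : ι → ℝ) :
    HoffmanAlternative a b := by
  classical
  let f : ι → E →ₗ[ℝ] ℝ := fun i => a i ∘ₗ LinearMap.inl ℝ E ℝ
  let α : ι → ℝ := fun i => a i (0, 1)
  have hdec : ∀ i x s, a i (x, s) = f i x + s * α i := by
    intro i x s
    have : ((x, s) : E × ℝ) = (x, 0) + s • (0, 1) := by simp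
    rw [this, map_add, map_smul, smul_eq_mul]
    rfl
  -- The projected system: constraints free of the last variable are kept, and pairs with
  -- coefficients of opposite sign are weighted so that it cancels. Unused indices carry `0 ≤ 0`.
  let a' : ι ⊕ ι × ι → E →ₗ[ℝ] ℝ := Sum.elim (fun i => if α i = 0 then f i else 0)
    (fun ij => if 0 < α ij.1 ∧ α ij.2 < 0 then (-α ij.2) • f ij.1 + α ij.1 • f ij.2 else 0)
  let b' : ι ⊕ ι × ι → ℝ := Sum.elim (fun i => if α i = 0 then b i else 0)
    (fun ij => if 0 < α ij.1 ∧ α ij.2 < 0 then (-α ij.2) * b ij.1 + α ij.1 * b ij.2 else 0)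
  obtain ⟨M, hM1, hM⟩ : ∃ M : ℝ, 1 ≤ M ∧ ∀ i, |α i| ≤ M := by
    have h0 : 0 ≤ ∑ i, |α i| := Finset.sum_nonneg fun i _ => abs_nonneg _
    refine ⟨1 + ∑ i, |α i|, by linarith, fun i => ?_⟩
    linarith [Finset.single_le_sum (f := fun i => |α i|) (fun i _ => abs_nonneg (α i))
      (Finset.mem_univ i)]
  have hviol : ∀ x s r, 0 ≤ r → (∀ i, a i (x, s) ≤ b i + r) →
      ∀ k, a' k x ≤ b' k + 2 * M * r := by
    intro x s r hr h k
    have hMr : r ≤ M * r := le_mul_of_one_le_left hr hM1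
    rcases k with i | ⟨i, j⟩
    · by_cases h0 : α i = 0
      · have := h i
        rw [hdec, h0] at this
        simp only [a', b', Sum.elim_inl, h0, if_true]
        linarith
      · simp only [a', b', Sum.elim_inl, h0, if_false, LinearMap.zero_apply]
        linarith
    · by_cases h0 : 0 < α i ∧ α j < 0
      · have hi := h i
        have hj := h j
        rw [hdec] at hi hj
        simp only [a', b', Sum.elim_inr, h0, and_self, if_true, LinearMap.add_apply,
          LinearMap.smul_apply, smul_eq_mul]
        have e1 := mul_le_mul_of_nonneg_left hi (neg_pos.2 h0.2).le
        have e2 := mul_le_mul_of_nonneg_left hj h0.1.le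
        have e3 := mul_le_mul_of_nonneg_right (le_of_abs_le (hM i)) hr
        have e4 := mul_le_mul_of_nonneg_right (neg_le_of_abs_le (hM j)) hr
        linarith
      · simp only [a', b', Sum.elim_inr, h0, if_false, LinearMap.zero_apply]
        linarith
  rcases hE a' b' with ⟨C, hC, hsol⟩ | ⟨ε, hε, hgap⟩
  · left
    obtain ⟨K, hK0, hK⟩ : ∃ K : ℝ, 0 ≤ K ∧ ∀ i x, |f i x| ≤ K * ‖x‖ := by
      refine ⟨∑ i, ‖LinearMap.toContinuousLinearMap (f i)‖,
        Finset.sum_nonneg fun i _ => norm_nonneg _, fun i x => ?_⟩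
      refine ((LinearMap.toContinuousLinearMap (f i)).le_opNorm x).trans ?_
      exact mul_le_mul_of_nonneg_right (Finset.single_le_sum
        (f := fun i => ‖LinearMap.toContinuousLinearMap (f i)‖)
        (fun i _ => norm_nonneg _) (Finset.mem_univ i)) (norm_nonneg _)
    -- Indices with `α i = 0` do no harm, since the inverse of `0` is `0`.
    obtain ⟨m, hm0, hm⟩ : ∃ m : ℝ, 0 ≤ m ∧ ∀ i, |α i|⁻¹ ≤ m :=
      ⟨∑ i, |α i|⁻¹, Finset.sum_nonneg fun i _ => by positivity, fun i =>
        Finset.single_le_sum (f := fun i => |α i|⁻¹) (fun i _ => by positivity)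
          (Finset.mem_univ i)⟩
    set D := C * (2 * M) with hD
    have hD0 : 0 ≤ D := by positivity
    refine ⟨D + m * (1 + K * D), by positivity, ?_⟩
    rintro ⟨x, s⟩ r hr h
    obtain ⟨y, hy, hxy⟩ := hsol x (2 * M * r) (by positivity) (hviol x s r hr h)
    have hxy' : ‖x - y‖ ≤ D * r := by rw [hD]; linarith
    -- Above `y` each constraint is violated by at most `(1 + K * D) * r`; dividing by `|α i|` costs
    -- at most the factor `m`, so `s` needs to move by at most `δ`.
    set δ := m * ((1 + K * D) * r) with hδ
    have hfy : ∀ i, f i y + s * α i ≤ b i + (1 + K * D) * r := by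
      intro i
      have h1 := h i
      rw [hdec] at h1
      have h2 := neg_le_of_abs_le (hK i (x - y))
      rw [map_sub] at h2
      have := mul_le_mul_of_nonneg_left hxy' hK0
      linarith
    have hscale : ∀ i, α i ≠ 0 → (1 + K * D) * r ≤ |α i| * δ := by
      intro i hi
      have hpos : 0 < |α i| := abs_pos.2 hi
      have h1 : 1 ≤ |α i| * m := by
        have := mul_le_mul_of_nonneg_left (hm i) hpos.le
        rwa [mul_inv_cancel₀ hpos.ne'] at this
      have h2 : 0 ≤ (1 + K * D) * r := by positivity
      calc (1 + K * D) * r ≤ (|α i| * m) * ((1 + K * D) * r) := le_mul_of_one_le_left h2 h1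
        _ = _ := by rw [hδ]; ring
    obtain ⟨s', hl, hu, hs⟩ := exists_between_near (p := fun i => α i < 0) (q := fun i => 0 < α i)
      (l := fun i => (b i - f i y) / α i) (u := fun i => (b i - f i y) / α i) (s := s) (δ := δ)
      (by positivity)
      (by
        intro j i hj hi
        have := hy (Sum.inr (i, j))
        simp only [a', b', Sum.elim_inr, hi, hj, and_self, if_true, LinearMap.add_apply,
          LinearMap.smul_apply, smul_eq_mul] at this
        rw [le_div_iff₀ hi, div_mul_eq_mul_div, div_le_iff_of_neg hj]
        linarith)
      (by
        intro j hj
        have h1 := hfy j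
        have h2 := hscale j hj.ne
        rw [abs_of_neg hj] at h2
        rw [sub_le_iff_le_add, div_le_iff_of_neg hj]
        linarith)
      (by
        intro i hi
        have h1 := hfy i
        have h2 := hscale i hi.ne'
        rw [abs_of_pos hi] at h2
        rw [← sub_le_iff_le_add, le_div_iff₀ hi]
        linarith)
    refine ⟨(y, s'), fun i => ?_, ?_⟩
    · rw [hdec]
      rcases lt_trichotomy (α i) 0 with hi | hi | hi
      · have := hl i hi
        rw [div_le_iff_of_neg hi] at this
        linarith
      · have := hy (Sum.inl i)
        simp only [a', b', Sum.elim_inl, hi, if_true] at this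
        rw [hi]; linarith
      · have := hu i hi
        rw [le_div_iff₀ hi] at this
        linarith
    · rw [Prod.mk_sub_mk, Prod.norm_mk, Real.norm_eq_abs]
      have e1 : 0 ≤ D * r := by positivity
      have e2 : 0 ≤ δ := by positivity
      refine max_le ?_ ?_ <;> nlinarith [hδ]
  · right
    refine ⟨ε / (2 * M), by positivity, ?_⟩
    rintro ⟨x, s⟩ r hr h
    rw [div_le_iff₀ (by positivity)]
    linarith [hgap x (2 * M * r) (by positivity) (hviol x s r hr h)]

theorem HoffmanAlternative.of_equiv {E E' : Type*} [NormedAddCommGroup E] [NormedSpace ℝ E]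
    [NormedAddCommGroup E'] [NormedSpace ℝ E'] (e : E ≃L[ℝ] E') {ι : Type}
    {a : ι → E →ₗ[ℝ] ℝ} {b : ι → ℝ}
    (h : HoffmanAlternative (fun i => a i ∘ₗ (e.symm : E' →ₗ[ℝ] E)) b) :
    HoffmanAlternative a b := by
  rcases h with ⟨C, hC, h⟩ | ⟨ε, hε, h⟩
  · left
    refine ⟨‖(e.symm : E' →L[ℝ] E)‖ * C, by positivity, fun x r hr hx => ?_⟩
    obtain ⟨y, hy, hxy⟩ := h (e x) r hr (by simpa using hx)
    refine ⟨e.symm y, hy, ?_⟩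
    calc ‖x - e.symm y‖ = ‖(e.symm : E' →L[ℝ] E) (e x - y)‖ := by simp
      _ ≤ ‖(e.symm : E' →L[ℝ] E)‖ * ‖e x - y‖ := ContinuousLinearMap.le_opNorm _ _
      _ ≤ _ := by rw [mul_assoc]; gcongr
  · right
    exact ⟨ε, hε, fun x r hr hx => h (e x) r hr (by simpa using hx)⟩

theorem hoffmanAlternative_pi (n : ℕ) {ι : Type} [Fintype ι] (a : ι → (Fin n → ℝ) →ₗ[ℝ] ℝ)
    (b : ι → ℝ) : HoffmanAlternative a b := by
  induction n generalizing ι with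
  | zero =>
    have h0 : ∀ i (x : Fin 0 → ℝ), a i x = 0 := fun i x => by
      rw [Subsingleton.elim x 0, map_zero]
    by_cases h : ∀ i, 0 ≤ b i
    · left
      exact ⟨0, le_rfl, fun x r _ _ => ⟨x, fun i => (h0 i x).trans_le (h i), by simp⟩⟩
    · right
      push Not at h
      obtain ⟨i, hi⟩ := h
      refine ⟨-b i, by linarith, fun x r _ hx => ?_⟩
      have := hx i
      rw [h0] at this
      linarith
  | succ n ih =>
    have e : (Fin (n + 1) → ℝ) ≃L[ℝ] (Fin n → ℝ) × ℝ :=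
      ContinuousLinearEquiv.ofFinrankEq (by simp)
    exact .of_equiv e (.prod ih _ _)

theorem hoffmanAlternative {E : Type*} [NormedAddCommGroup E] [NormedSpace ℝ E]
    [FiniteDimensional ℝ E] {ι : Type} [Fintype ι] (a : ι → E →ₗ[ℝ] ℝ) (b : ι → ℝ) :
    HoffmanAlternative a b :=
  .of_equiv (ContinuousLinearEquiv.ofFinrankEq (by simp) :
    E ≃L[ℝ] (Fin (Module.finrank ℝ E) → ℝ)) (hoffmanAlternative_pi _ _ _)

/-! ### Mixed affine systems as linear inequalities -/

section LinearSystems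

variable {E : Type*} [NormedAddCommGroup E] [NormedSpace ℝ E]
  {H : Type*} [NormedAddCommGroup H] [NormedSpace ℝ H] [FiniteDimensional ℝ H] {n : ℕ}

theorem affineMap_apply_eq {E' H' : Type*} [AddCommGroup E'] [Module ℝ E'] [AddCommGroup H']
    [Module ℝ H'] (A : E' →ᵃ[ℝ] H') (x : E') : A x = A.linear x + A 0 :=
  congrFun A.decomp x

/-- Each equation becomes two opposite inequalities per coordinate of a basis of `H`. The constant
`κ` absorbs the coordinate norms, and its summand `1` covers the inequalities coming from `B`. -/
theorem exists_linear_system (A : E →ᵃ[ℝ] H) (B : E →ᵃ[ℝ] (Fin n → ℝ)) :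
    ∃ (ι : Type) (_ : Fintype ι) (a : ι → E →ₗ[ℝ] ℝ) (b : ι → ℝ) (κ : ℝ), 1 ≤ κ ∧
      (∀ x, (∀ i, a i x ≤ b i) ↔ A x = 0 ∧ ∀ j, B x j ≤ 0) ∧
      ∀ x r, 0 ≤ r → ‖A x‖ ≤ r → (∀ j, B x j ≤ r) → ∀ i, a i x ≤ b i + κ * r := by
  let β := Module.finBasis ℝ H
  let κ : ℝ := 1 + ∑ k, ‖LinearMap.toContinuousLinearMap (β.coord k)‖
  have hκ1 : 1 ≤ κ := by
    have : 0 ≤ ∑ k, ‖LinearMap.toContinuousLinearMap (β.coord k)‖ :=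
      Finset.sum_nonneg fun _ _ => norm_nonneg _
    simp only [κ]; linarith
  have hκ : ∀ k v, |β.coord k v| ≤ κ * ‖v‖ := by
    intro k v
    refine ((LinearMap.toContinuousLinearMap (β.coord k)).le_opNorm v).trans ?_
    refine mul_le_mul_of_nonneg_right ?_ (norm_nonneg _)
    have := Finset.single_le_sum (f := fun k => ‖LinearMap.toContinuousLinearMap (β.coord k)‖)
      (fun i _ => norm_nonneg _) (Finset.mem_univ k)
    simp only [κ]; linarith
  refine ⟨(Fin (Module.finrank ℝ H) ⊕ Fin (Module.finrank ℝ H)) ⊕ Fin n, inferInstance,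
    Sum.elim (Sum.elim (fun k => β.coord k ∘ₗ A.linear) (fun k => -(β.coord k ∘ₗ A.linear)))
      (fun j => LinearMap.proj j ∘ₗ B.linear),
    Sum.elim (Sum.elim (fun k => -β.coord k (A 0)) (fun k => β.coord k (A 0))) (fun j => -B 0 j),
    κ, hκ1, fun x => ?_, fun x r hr hA hB => ?_⟩
  · have hAx : A x = 0 ↔ ∀ k, β.coord k (A x) = 0 := (β.forall_coord_eq_zero_iff).symm
    rw [hAx, affineMap_apply_eq A x, affineMap_apply_eq B x]
    simp only [Sum.forall, Sum.elim_inl, Sum.elim_inr, LinearMap.comp_apply, LinearMap.neg_apply,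
      map_add, LinearMap.proj_apply, Pi.add_apply]
    constructor
    · rintro ⟨⟨h1, h2⟩, h3⟩
      exact ⟨fun k => by linarith [h1 k, h2 k], fun j => by linarith [h3 j]⟩
    · rintro ⟨h1, h3⟩
      exact ⟨⟨fun k => by linarith [h1 k], fun k => by linarith [h1 k]⟩,
        fun j => by linarith [h3 j]⟩
  · have hc : ∀ k, |β.coord k (A.linear x) + β.coord k (A 0)| ≤ κ * r := by
      intro k
      rw [← map_add, ← affineMap_apply_eq]
      exact (hκ k _).trans (mul_le_mul_of_nonneg_left hA (by linarith))
    rintro ((k | k) | j)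
    · simp only [Sum.elim_inl, LinearMap.comp_apply]
      linarith [le_of_abs_le (hc k)]
    · simp only [Sum.elim_inl, Sum.elim_inr, LinearMap.comp_apply, LinearMap.neg_apply]
      linarith [neg_le_of_abs_le (hc k)]
    · have := hB j
      rw [affineMap_apply_eq B x, Pi.add_apply] at this
      simp only [Sum.elim_inr, LinearMap.comp_apply, LinearMap.proj_apply]
      linarith [le_mul_of_one_le_left hr hκ1]

/-- Hoffman's alternative for mixed systems of affine equations and inequalities. -/
theorem hoffmanAlternative_affine [FiniteDimensional ℝ E] {ι : Type} [Fintype ι]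
    (a : ι → E →ₗ[ℝ] ℝ) (b : ι → ℝ) (A : E →ᵃ[ℝ] H) (B : E →ᵃ[ℝ] (Fin n → ℝ)) :
    (∃ C, 0 ≤ C ∧ ∀ x r, 0 ≤ r → (∀ i, a i x ≤ b i + r) → ‖A x‖ ≤ r → (∀ j, B x j ≤ r) →
      ∃ y, (∀ i, a i y ≤ b i) ∧ A y = 0 ∧ (∀ j, B y j ≤ 0) ∧ ‖x - y‖ ≤ C * r) ∨
    ∃ ε, 0 < ε ∧ ∀ x r, 0 ≤ r → (∀ i, a i x ≤ b i + r) → ‖A x‖ ≤ r → (∀ j, B x j ≤ r) →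
      ε ≤ r := by
  obtain ⟨ι', _, a', b', κ, hκ, hiff, hle⟩ := exists_linear_system A B
  have hviol : ∀ x r, 0 ≤ r → (∀ i, a i x ≤ b i + r) → ‖A x‖ ≤ r → (∀ j, B x j ≤ r) →
      ∀ i, Sum.elim a a' i x ≤ Sum.elim b b' i + κ * r := by
    rintro x r hr h1 h2 h3 (i | i)
    · simp only [Sum.elim_inl]
      linarith [h1 i, le_mul_of_one_le_left hr hκ]
    · exact hle x r hr h2 h3 i
  rcases hoffmanAlternative (Sum.elim a a') (Sum.elim b b') with ⟨C, hC, h⟩ | ⟨ε, hε, h⟩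
  · left
    refine ⟨C * κ, by positivity, fun x r hr h1 h2 h3 => ?_⟩
    obtain ⟨y, hy, hxy⟩ := h x (κ * r) (by positivity) (hviol x r hr h1 h2 h3)
    have := (hiff y).1 fun i => hy (Sum.inr i)
    exact ⟨y, fun i => hy (Sum.inl i), this.1, this.2, by linarith⟩
  · right
    refine ⟨ε / κ, by positivity, fun x r hr h1 h2 h3 => ?_⟩
    rw [div_le_iff₀ (by positivity)]
    linarith [h x (κ * r) (by positivity) (hviol x r hr h1 h2 h3)]

end LinearSystems

/-! ### Polyhedral sets and their recession directions -/

section Polyhedral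

variable {E : Type*} [NormedAddCommGroup E] [NormedSpace ℝ E]

theorem isPolyhedral_setOf {ι : Type} [Fintype ι] (a : ι → E →ₗ[ℝ] ℝ) (b : ι → ℝ) :
    IsPolyhedral {x | ∀ i, a i x ≤ b i} := by
  let e := Fintype.equivFin ι
  refine ⟨Fintype.card ι, a ∘ e.symm, b ∘ e.symm, ?_⟩
  ext x
  exact ⟨fun h i => h _, fun h i => by simpa using h (e i)⟩

theorem IsPolyhedral.inter {P Q : Set E} (hP : IsPolyhedral P) (hQ : IsPolyhedral Q) :
    IsPolyhedral (P ∩ Q) := by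
  obtain ⟨k, a, b, rfl⟩ := hP
  obtain ⟨l, a', b', rfl⟩ := hQ
  convert isPolyhedral_setOf (Sum.elim a a') (Sum.elim b b') using 1
  ext x
  simp [Sum.forall]

theorem isPolyhedral_solutionSet_affine {H : Type*} [NormedAddCommGroup H] [NormedSpace ℝ H]
    [FiniteDimensional ℝ H] {n : ℕ} (A : E →ᵃ[ℝ] H) (B : E →ᵃ[ℝ] (Fin n → ℝ)) :
    IsPolyhedral (solutionSet A B) := by
  obtain ⟨ι, _, a, b, -, -, hiff, -⟩ := exists_linear_system A B
  convert isPolyhedral_setOf a b using 1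
  ext x
  exact (hiff x).symm

theorem IsPolyhedral.convex {Q : Set E} (hQ : IsPolyhedral Q) : Convex ℝ Q := by
  obtain ⟨k, a, b, rfl⟩ := hQ
  rw [Set.ofPred_forall]
  exact convex_iInter fun i => convex_halfSpace_le (a i).isLinear _

theorem IsPolyhedral.isClosed [FiniteDimensional ℝ E] {Q : Set E} (hQ : IsPolyhedral Q) :
    IsClosed Q := by
  obtain ⟨k, a, b, rfl⟩ := hQ
  rw [Set.ofPred_forall]
  exact isClosed_iInter fun i =>
    isClosed_le (LinearMap.continuous_of_finiteDimensional (a i)) continuous_const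

/-- Limits of rescaled points of a finite union of polyhedral sets are directions of recession of
one of them. -/
theorem exists_recession_of_tendsto [FiniteDimensional ℝ E] {ι : Type*} [Finite ι]
    {Q : ι → Set E} (hQ : ∀ i, IsPolyhedral (Q i)) {w : ℕ → E} {s : ℕ → ℝ} {u : E}
    (hw : ∀ k, ∃ i, w k ∈ Q i) (hs : Tendsto s atTop atTop)
    (hu : Tendsto (fun k => (s k)⁻¹ • w k) atTop (𝓝 u)) :
    ∃ i, (∃ᶠ k in atTop, w k ∈ Q i) ∧ ∀ x ∈ Q i, ∀ t : ℝ, 0 ≤ t → x + t • u ∈ Q i := by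
  obtain ⟨i, hi⟩ := frequently_exists.1 (Eventually.frequently (Eventually.of_forall hw) :
    ∃ᶠ k in atTop, ∃ i, w k ∈ Q i)
  refine ⟨i, hi, ?_⟩
  obtain ⟨m, a, b, hab⟩ := hQ i
  -- Dividing `a j (w k) ≤ b j` by `s k` makes the right side vanish in the limit along the
  -- infinitely many `k` with `w k ∈ Q i`.
  have ha : ∀ j, a j u ≤ 0 := by
    intro j
    have h1 : Tendsto (fun k => a j ((s k)⁻¹ • w k)) atTop (𝓝 (a j u)) :=
      ((LinearMap.continuous_of_finiteDimensional (a j)).tendsto u).comp hu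
    have h2 : Tendsto (fun k => (s k)⁻¹ * b j) atTop (𝓝 0) := by
      simpa using hs.inv_tendsto_atTop.mul_const (b j)
    refine le_of_tendsto_of_tendsto_of_frequently h1 h2 ?_
    refine (hi.and_eventually (hs.eventually_ge_atTop 0)).mono fun k hk => ?_
    rw [map_smul, smul_eq_mul]
    have := hk.1
    rw [hab] at this
    exact mul_le_mul_of_nonneg_left (this j) (inv_nonneg.2 hk.2)
  intro x hx t ht
  rw [hab] at hx ⊢
  intro j
  rw [map_add, map_smul, smul_eq_mul]
  linarith [hx j, mul_nonpos_of_nonneg_of_nonpos ht (ha j)]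

end Polyhedral

/-! ### Lipschitz continuity of piecewise affine maps -/

section Lipschitz

variable {E : Type*} [NormedAddCommGroup E] [NormedSpace ℝ E] [FiniteDimensional ℝ E]
  {H : Type*} [NormedAddCommGroup H] [NormedSpace ℝ H]

theorem IsPiecewiseAffine.continuous {F : E → H} (hF : IsPiecewiseAffine F) : Continuous F := by
  obtain ⟨s, Q, A, ⟨hQ, hcov, -, -⟩, hFA⟩ := hF
  refine (locallyFinite_of_finite Q).continuous hcov (fun i => (hQ i).isClosed) fun i => ?_
  exact (AffineMap.continuous_of_finiteDimensional (A i)).continuousOn.congr (hFA i)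

/-- A piecewise affine map is Lipschitz continuous. -/
theorem IsPiecewiseAffine.exists_lipschitz {F : E → H} (hF : IsPiecewiseAffine F) :
    ∃ L, 0 ≤ L ∧ ∀ x y, ‖F x - F y‖ ≤ L * ‖x - y‖ := by
  have hcont := hF.continuous
  obtain ⟨s, Q, A, ⟨hQ, hcov, -, -⟩, hFA⟩ := hF
  let N : Fin s → ℝ := fun i => ‖LinearMap.toContinuousLinearMap (A i).linear‖
  refine ⟨∑ i, N i, Finset.sum_nonneg fun i _ => norm_nonneg _, fun x y => ?_⟩
  have hN : ∀ i v, ‖(A i).linear v‖ ≤ (∑ i, N i) * ‖v‖ := fun i v =>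
    ((LinearMap.toContinuousLinearMap (A i).linear).le_opNorm v).trans <|
      mul_le_mul_of_nonneg_right (Finset.single_le_sum (f := N) (fun i _ => norm_nonneg _)
        (Finset.mem_univ i)) (norm_nonneg _)
  set v := x - y with hv
  let γ : ℝ → E := fun t => y + t • v
  have hγ : Continuous γ := by fun_prop
  -- Some piece meets the segment at points arbitrarily close to the right of `t`. Being closed and
  -- convex, it contains a whole right interval, on which `F ∘ γ` is affine.
  have hder : ∀ t : ℝ, ∃ i, HasDerivWithinAt (F ∘ γ) ((A i).linear v) (Set.Ici t) t := by
    intro t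
    have hall : ∀ᶠ r in 𝓝[>] t, ∃ i, γ r ∈ Q i := Eventually.of_forall fun r => by
      simpa using hcov.ge (Set.mem_univ (γ r))
    obtain ⟨i, hi⟩ := frequently_exists.1 hall.frequently
    have hγt : γ t ∈ Q i := by
      refine (hQ i).isClosed.mem_of_frequently_of_tendsto hi ?_
      exact (hγ.tendsto t).mono_left nhdsWithin_le_nhds
    obtain ⟨r, hr, htr⟩ := (hi.and_eventually self_mem_nhdsWithin).exists
    have htr : t < r := htr
    have hconv : Convex ℝ (γ ⁻¹' Q i) := by
      have hline : γ = AffineMap.lineMap (k := ℝ) y (y + v) := by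
        ext q
        simp [γ, AffineMap.lineMap_apply, add_comm]
      rw [hline]
      exact (hQ i).convex.affine_preimage _
    have hseg : Set.Icc t r ⊆ γ ⁻¹' Q i := hconv.ordConnected.out hγt hr
    have heq : Set.EqOn (F ∘ γ) (fun r => A i y + r • (A i).linear v) (Set.Icc t r) := by
      intro q hq
      simp only [Function.comp_apply, hFA i _ (hseg hq), γ]
      rw [affineMap_apply_eq (A i) (y + q • v), affineMap_apply_eq (A i) y, map_add, map_smul]
      abel
    refine ⟨i, ?_⟩
    have hd : HasDerivWithinAt (fun r : ℝ => A i y + r • (A i).linear v) ((A i).linear v)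
        (Set.Ici t) t := by
      simpa using (((hasDerivAt_id t).smul_const ((A i).linear v)).const_add (A i y)).hasDerivWithinAt
    refine hd.congr_of_eventuallyEq ?_ (heq ⟨le_rfl, htr.le⟩)
    filter_upwards [Icc_mem_nhdsGE htr] with q hq using heq hq
  choose i hi using hder
  have := norm_image_sub_le_of_norm_deriv_right_le_segment (f := F ∘ γ) (a := 0) (b := 1)
    (C := (∑ i, N i) * ‖v‖) (hcont.comp hγ).continuousOn (fun t _ => hi t)
    (fun t _ => hN _ _) 1 ⟨zero_le_one, le_rfl⟩
  simpa [γ, hv] using this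

end Lipschitz

/-! ### The residual and its behaviour on affine pieces -/

section Residual

variable {E : Type*} {H : Type*} [NormedAddCommGroup H] {n : ℕ}

theorem systemResidual_nonneg (F : E → H) (G : E → Fin n → ℝ) (x : E) :
    0 ≤ systemResidual F G x :=
  add_nonneg (norm_nonneg _) (Finset.sum_nonneg fun _ _ => le_max_right _ _)

theorem norm_le_systemResidual (F : E → H) (G : E → Fin n → ℝ) (x : E) :
    ‖F x‖ ≤ systemResidual F G x :=
  le_add_of_nonneg_right (Finset.sum_nonneg fun _ _ => le_max_right _ _)

theorem le_systemResidual (F : E → H) (G : E → Fin n → ℝ) (x : E) (j : Fin n) :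
    G x j ≤ systemResidual F G x := by
  have h := Finset.single_le_sum (f := fun i => max (G x i) 0) (fun i _ => le_max_right _ _)
    (Finset.mem_univ j)
  exact ((le_max_left _ _).trans h).trans (le_add_of_nonneg_left (norm_nonneg _))

theorem systemResidual_eq_zero {F : E → H} {G : E → Fin n → ℝ} {x : E}
    (hx : x ∈ solutionSet F G) : systemResidual F G x = 0 := by
  simp [systemResidual, hx.1, hx.2]

theorem systemResidual_le_zero_iff {F : E → H} {G : E → Fin n → ℝ} {x : E} :
    systemResidual F G x ≤ 0 ↔ x ∈ solutionSet F G :=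
  ⟨fun h => ⟨norm_le_zero_iff.1 ((norm_le_systemResidual F G x).trans h),
    fun j => (le_systemResidual F G x j).trans h⟩, fun h => (systemResidual_eq_zero h).le⟩

variable [NormedAddCommGroup E] [NormedSpace ℝ E] [NormedSpace ℝ H]

theorem exists_lipschitz_systemResidual [FiniteDimensional ℝ E] {F : E → H} {G : E → Fin n → ℝ}
    (hF : IsPiecewiseAffine F) (hG : IsPiecewiseAffine G) :
    ∃ L, 0 ≤ L ∧ ∀ x y, systemResidual F G x ≤ systemResidual F G y + L * ‖x - y‖ := by
  obtain ⟨K, hK, hFK⟩ := hF.exists_lipschitz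
  obtain ⟨M, hM, hGM⟩ := hG.exists_lipschitz
  refine ⟨K + n * M, by positivity, fun x y => ?_⟩
  have h1 : ‖F x‖ ≤ ‖F y‖ + K * ‖x - y‖ := by
    linarith [norm_sub_norm_le (F x) (F y), hFK x y]
  have h2 : ∑ i, max (G x i) 0 ≤ ∑ i, (max (G y i) 0 + M * ‖x - y‖) := by
    refine Finset.sum_le_sum fun i _ => ?_
    have h3 := (norm_le_pi_norm (G x - G y) i).trans (hGM x y)
    rw [Pi.sub_apply, Real.norm_eq_abs] at h3
    have h4 := le_of_abs_le h3
    refine max_le ?_ (by positivity)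
    linarith [le_max_left (G y i) 0]
  rw [Finset.sum_add_distrib, Finset.sum_const, Finset.card_univ, Fintype.card_fin,
    nsmul_eq_mul] at h2
  simp only [systemResidual]
  linarith

theorem convexOn_systemResidual (A : E →ᵃ[ℝ] H) (B : E →ᵃ[ℝ] (Fin n → ℝ)) :
    ConvexOn ℝ Set.univ (systemResidual A B) := by
  refine ⟨convex_univ, fun x _ y _ s t hs ht hst => ?_⟩
  simp only [systemResidual, Convex.combo_affine_apply hst]
  have h1 : ‖s • A x + t • A y‖ ≤ s * ‖A x‖ + t * ‖A y‖ := by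
    refine (norm_add_le _ _).trans ?_
    rw [norm_smul_of_nonneg hs, norm_smul_of_nonneg ht]
  have h2 : ∑ i, max ((s • B x + t • B y) i) 0 ≤
      ∑ i, (s * max (B x i) 0 + t * max (B y i) 0) := by
    refine Finset.sum_le_sum fun i _ => max_le ?_ (by positivity)
    simp only [Pi.add_apply, Pi.smul_apply, smul_eq_mul]
    gcongr <;> exact le_max_left _ _
  rw [Finset.sum_add_distrib, ← Finset.mul_sum, ← Finset.mul_sum] at h2
  simp only [smul_eq_mul]
  linarith

theorem affineMap_apply_ray {E' H' : Type*} [AddCommGroup E'] [Module ℝ E'] [AddCommGroup H']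
    [Module ℝ H'] (A : E' →ᵃ[ℝ] H') (x z : E') {t : ℝ} (ht : t ≠ 0) :
    A (x + t • z) = t • (t⁻¹ • A x + A.linear z) := by
  rw [affineMap_apply_eq A (x + t • z), affineMap_apply_eq A x, map_add, map_smul, smul_add,
    smul_inv_smul₀ ht]
  abel

theorem tendsto_systemResidual_affine (A : E →ᵃ[ℝ] H) (B : E →ᵃ[ℝ] (Fin n → ℝ)) (x z : E) :
    Tendsto (fun t : ℝ => systemResidual A B (x + t • z) / t) atTop
      (𝓝 (systemResidual A.linear B.linear z)) := by
  have hA : Tendsto (fun t : ℝ => t⁻¹ • A x + A.linear z) atTop (𝓝 (A.linear z)) := by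
    simpa using ((tendsto_inv_atTop_zero (𝕜 := ℝ)).smul_const (A x)).add_const (A.linear z)
  have hB : ∀ i, Tendsto (fun t : ℝ => t⁻¹ * B x i + B.linear z i) atTop
      (𝓝 (B.linear z i)) := fun i => by
    simpa using (tendsto_inv_atTop_zero.mul_const (B x i)).add_const (B.linear z i)
  have := hA.norm.add (tendsto_finsetSum Finset.univ fun i _ =>
    (hB i).max (tendsto_const_nhds (x := (0 : ℝ))))
  refine this.congr' ?_
  filter_upwards [eventually_gt_atTop 0] with t ht
  have hmax : ∀ r : ℝ, max (t * r) 0 = t * max r 0 := fun r => by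
    rw [mul_max_of_nonneg _ _ ht.le, mul_zero]
  have hlinB : ∀ i, B (x + t • z) i = t * (t⁻¹ * B x i + B.linear z i) := fun i => by
    rw [affineMap_apply_ray B x z ht.ne']; rfl
  rw [systemResidual, affineMap_apply_ray A x z ht.ne', norm_smul_of_nonneg ht.le]
  simp only [hlinB, hmax]
  rw [← Finset.mul_sum, ← mul_add, mul_div_cancel_left₀ _ ht.ne']

end Residual

/-! ### Common polyhedral pieces for `F` and `G` -/

section Decomposition

variable {E : Type*} [NormedAddCommGroup E] [NormedSpace ℝ E]
  {H : Type*} [NormedAddCommGroup H] [NormedSpace ℝ H] {n : ℕ}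

/-- A finite cover of the space by polyhedral sets on each of which both `F` and `G` are affine. -/
structure AffineDecomposition (F : E → H) (G : E → Fin n → ℝ) where
  ι : Type
  finite : Finite ι
  P : ι → Set E
  A : ι → E →ᵃ[ℝ] H
  B : ι → E →ᵃ[ℝ] (Fin n → ℝ)
  isPolyhedral : ∀ p, IsPolyhedral (P p)
  cover : ∀ x, ∃ p, x ∈ P p
  eq_A : ∀ p, ∀ x ∈ P p, F x = A p x
  eq_B : ∀ p, ∀ x ∈ P p, G x = B p x

attribute [instance] AffineDecomposition.finite

theorem exists_affineDecomposition {F : E → H} {G : E → Fin n → ℝ} (hF : IsPiecewiseAffine F)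
    (hG : IsPiecewiseAffine G) : Nonempty (AffineDecomposition F G) := by
  obtain ⟨s, Q, A, ⟨hQ, hQcov, -, -⟩, hA⟩ := hF
  obtain ⟨s', R, B, ⟨hR, hRcov, -, -⟩, hB⟩ := hG
  refine ⟨⟨Fin s × Fin s', inferInstance, fun p => Q p.1 ∩ R p.2, fun p => A p.1,
    fun p => B p.2, fun p => (hQ p.1).inter (hR p.2), fun x => ?_, fun p x hx => hA _ x hx.1,
    fun p x hx => hB _ x hx.2⟩⟩
  obtain ⟨i, hi⟩ := Set.mem_iUnion.1 (hQcov.ge (Set.mem_univ x))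
  obtain ⟨j, hj⟩ := Set.mem_iUnion.1 (hRcov.ge (Set.mem_univ x))
  exact ⟨(i, j), hi, hj⟩

namespace AffineDecomposition

variable {F : E → H} {G : E → Fin n → ℝ} (D : AffineDecomposition F G)

theorem systemResidual_eq {p : D.ι} {x : E} (hx : x ∈ D.P p) :
    systemResidual F G x = systemResidual (D.A p) (D.B p) x := by
  simp only [systemResidual, D.eq_A p x hx, D.eq_B p x hx]

/-- The part of the solution set in one piece of the decomposition. -/
def solutionPiece (p : D.ι) : Set E := D.P p ∩ solutionSet (D.A p) (D.B p)

theorem isPolyhedral_solutionPiece [FiniteDimensional ℝ H] (p : D.ι) :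
    IsPolyhedral (D.solutionPiece p) :=
  (D.isPolyhedral p).inter (isPolyhedral_solutionSet_affine _ _)

theorem mem_solutionSet_iff {x : E} : x ∈ solutionSet F G ↔ ∃ p, x ∈ D.solutionPiece p := by
  have key : ∀ p, x ∈ D.P p → (x ∈ solutionSet F G ↔ x ∈ solutionSet (D.A p) (D.B p)) := by
    intro p hp
    simp only [solutionSet, Set.mem_ofPred_eq, D.eq_A p x hp, D.eq_B p x hp]
  constructor
  · intro h
    obtain ⟨p, hp⟩ := D.cover x
    exact ⟨p, hp, (key p hp).1 h⟩
  · rintro ⟨p, hp, h⟩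
    exact (key p hp).2 h

end AffineDecomposition

end Decomposition

/-! ### Recession function and recession cone of the solution set -/

section Recession

variable {E : Type*} [NormedAddCommGroup E] [NormedSpace ℝ E]

theorem tendsto_inv_smul_ray (x z : E) :
    Tendsto (fun k : ℕ => (k : ℝ)⁻¹ • (x + (k : ℝ) • z)) atTop (𝓝 z) := by
  have h : Tendsto (fun k : ℕ => (k : ℝ)⁻¹ • x + z) atTop (𝓝 z) := by
    simpa using (((tendsto_inv_atTop_zero (𝕜 := ℝ)).comp tendsto_natCast_atTop_atTop).smul_const x).add_const
      z
  refine h.congr' ?_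
  filter_upwards [eventually_gt_atTop 0] with k hk
  have hk : (k : ℝ) ≠ 0 := by positivity
  rw [smul_add, inv_smul_smul₀ hk]

variable [FiniteDimensional ℝ E]

/-- A ray covered by finitely many polyhedral sets enters one of them for good. -/
theorem exists_recession_of_ray {ι : Type*} [Finite ι] {Q : ι → Set E}
    (hQ : ∀ i, IsPolyhedral (Q i)) {x z : E} (h : ∀ t : ℝ, 0 ≤ t → ∃ i, x + t • z ∈ Q i) :
    ∃ i, (∃ t : ℝ, 0 ≤ t ∧ x + t • z ∈ Q i) ∧
      ∀ y ∈ Q i, ∀ t : ℝ, 0 ≤ t → y + t • z ∈ Q i := by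
  obtain ⟨i, hi, hrec⟩ := exists_recession_of_tendsto hQ (w := fun k : ℕ => x + (k : ℝ) • z)
    (fun k => h k k.cast_nonneg) tendsto_natCast_atTop_atTop (tendsto_inv_smul_ray x z)
  obtain ⟨k, hk⟩ := hi.exists
  exact ⟨i, ⟨k, k.cast_nonneg, hk⟩, hrec⟩

variable {H : Type*} [NormedAddCommGroup H] [NormedSpace ℝ H] {n : ℕ}
  {F : E → H} {G : E → Fin n → ℝ}

/-- The base point `x` does not matter: by the Lipschitz property it changes the residual by at most
`L * ‖x‖`, which vanishes after division by `t`. -/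
theorem AffineDecomposition.tendsto_systemResidual (D : AffineDecomposition F G)
    (hF : IsPiecewiseAffine F) (hG : IsPiecewiseAffine G) {p : D.ι} {x z : E}
    (h : ∀ t : ℝ, 0 ≤ t → x + t • z ∈ D.P p) :
    Tendsto (fun t : ℝ => systemResidual F G (t • z) / t) atTop
      (𝓝 (systemResidual (D.A p).linear (D.B p).linear z)) := by
  obtain ⟨L, hL, hlip⟩ := exists_lipschitz_systemResidual hF hG
  have h1 : Tendsto (fun t : ℝ => systemResidual F G (x + t • z) / t) atTop
      (𝓝 (systemResidual (D.A p).linear (D.B p).linear z)) := by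
    refine (tendsto_systemResidual_affine (D.A p) (D.B p) x z).congr' ?_
    filter_upwards [eventually_ge_atTop 0] with t ht
    rw [D.systemResidual_eq (h t ht)]
  have h2 : Tendsto (fun t : ℝ => (systemResidual F G (t • z) - systemResidual F G (x + t • z)) / t)
      atTop (𝓝 0) := by
    have h3 : Tendsto (fun t : ℝ => L * ‖x‖ * t⁻¹) atTop (𝓝 0) := by
      simpa using tendsto_inv_atTop_zero.const_mul (L * ‖x‖)
    refine squeeze_zero_norm' ?_ h3
    filter_upwards [eventually_gt_atTop 0] with t ht
    rw [Real.norm_eq_abs, abs_div, abs_of_pos ht, div_eq_mul_inv]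
    refine mul_le_mul_of_nonneg_right (abs_le.2 ⟨?_, ?_⟩) (by positivity)
    · have := hlip (x + t • z) (t • z)
      rw [add_sub_cancel_right] at this
      linarith
    · have := hlip (t • z) (x + t • z)
      rw [sub_add_cancel_right, norm_neg] at this
      linarith
  convert h1.add h2 using 2
  · ring
  · ring

theorem AffineDecomposition.recessionFunction_eq (D : AffineDecomposition F G)
    (hF : IsPiecewiseAffine F) (hG : IsPiecewiseAffine G) {p : D.ι} {x z : E}
    (h : ∀ t : ℝ, 0 ≤ t → x + t • z ∈ D.P p) :
    recessionFunction (systemResidual F G) z =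
      systemResidual (D.A p).linear (D.B p).linear z :=
  (D.tendsto_systemResidual hF hG h).limUnder_eq

theorem tendsto_recessionFunction (hF : IsPiecewiseAffine F) (hG : IsPiecewiseAffine G) (z : E) :
    Tendsto (fun t : ℝ => systemResidual F G (t • z) / t) atTop
      (𝓝 (recessionFunction (systemResidual F G) z)) := by
  obtain ⟨D⟩ := exists_affineDecomposition hF hG
  obtain ⟨p, ⟨s, -, hs⟩, hrec⟩ := exists_recession_of_ray D.isPolyhedral (x := 0) (z := z)
    fun t _ => D.cover _
  have h := fun t ht => hrec _ hs t ht
  rw [D.recessionFunction_eq hF hG h]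
  exact D.tendsto_systemResidual hF hG h

variable [FiniteDimensional ℝ H]

/-- Asymptotic directions of sequences that stay close to the solution set, relative to their
size, belong to its recession cone. -/
theorem mem_recessionCone_solutionSet_of_tendsto (hF : IsPiecewiseAffine F)
    (hG : IsPiecewiseAffine G) (hΩ : (solutionSet F G).Nonempty) {x : ℕ → E} {s : ℕ → ℝ} {u : E}
    (hs : Tendsto s atTop atTop) (hu : Tendsto (fun k => (s k)⁻¹ • x k) atTop (𝓝 u))
    (hd : Tendsto (fun k => (s k)⁻¹ * Metric.infDist (x k) (solutionSet F G)) atTop (𝓝 0)) :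
    u ∈ recessionCone (solutionSet F G) := by
  obtain ⟨D⟩ := exists_affineDecomposition hF hG
  -- The infimum need not be known to be attained: the extra `1` disappears after division by `s k`.
  have hex : ∀ k, ∃ w ∈ solutionSet F G,
      dist (x k) w < Metric.infDist (x k) (solutionSet F G) + 1 := fun k =>
    (Metric.infDist_lt_iff hΩ).1 (lt_add_one _)
  choose w hw hxw using hex
  have hdiff : Tendsto (fun k => (s k)⁻¹ • (x k - w k)) atTop (𝓝 0) := by
    have h1 : Tendsto (fun k => (s k)⁻¹ * Metric.infDist (x k) (solutionSet F G) + (s k)⁻¹)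
        atTop (𝓝 0) := by
      simpa using hd.add hs.inv_tendsto_atTop
    refine squeeze_zero_norm' ?_ h1
    filter_upwards [hs.eventually_gt_atTop 0] with k hk
    rw [norm_smul_of_nonneg (by positivity), ← dist_eq_norm]
    have := mul_le_mul_of_nonneg_left (hxw k).le (inv_nonneg.2 hk.le)
    linarith
  have hwu : Tendsto (fun k => (s k)⁻¹ • w k) atTop (𝓝 u) := by
    have := hu.sub hdiff
    rw [sub_zero] at this
    refine this.congr fun k => ?_
    rw [← smul_sub, sub_sub_cancel]
  obtain ⟨p, hp, hrec⟩ := exists_recession_of_tendsto D.isPolyhedral_solutionPiece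
    (fun k => D.mem_solutionSet_iff.1 (hw k)) hs hwu
  obtain ⟨k, hk⟩ := hp.exists
  exact ⟨w k, hw k, fun t ht => D.mem_solutionSet_iff.2 ⟨p, hrec _ hk t ht⟩⟩

/-- Fix a point `w` in each nonempty solution piece. A direction `z` of `0⁺Ω` recedes in one of
these pieces, so `w + z ∈ Ω` lies at distance `‖w‖` from `z`. -/
theorem exists_infDist_recessionCone_le (hF : IsPiecewiseAffine F) (hG : IsPiecewiseAffine G) :
    ∃ W, 0 ≤ W ∧ ∀ z ∈ recessionCone (solutionSet F G),
      Metric.infDist z (solutionSet F G) ≤ W := by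
  obtain ⟨D⟩ := exists_affineDecomposition hF hG
  have hbd : ∀ᶠ W : ℝ in atTop, ∀ p, (D.solutionPiece p).Nonempty →
      ∃ w ∈ D.solutionPiece p, ‖w‖ ≤ W := by
    refine eventually_all.2 fun p => ?_
    by_cases hp : (D.solutionPiece p).Nonempty
    · obtain ⟨w, hw⟩ := hp
      filter_upwards [eventually_ge_atTop ‖w‖] with W hW using fun _ => ⟨w, hw, hW⟩
    · exact Eventually.of_forall fun W h => absurd h hp
  obtain ⟨W, hW, hW0⟩ := (hbd.and (eventually_ge_atTop 0)).exists
  refine ⟨W, hW0, ?_⟩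
  rintro z ⟨x, -, hx⟩
  obtain ⟨p, ⟨s, -, hs⟩, hrec⟩ := exists_recession_of_ray D.isPolyhedral_solutionPiece
    fun t ht => D.mem_solutionSet_iff.1 (hx t ht)
  obtain ⟨w, hw, hwW⟩ := hW p ⟨_, hs⟩
  have hz : w + z ∈ solutionSet F G :=
    D.mem_solutionSet_iff.2 ⟨p, by simpa using hrec w hw 1 zero_le_one⟩
  refine (Metric.infDist_le_dist_of_mem hz).trans ?_
  rw [dist_eq_norm, sub_add_cancel_right, norm_neg]
  exact hwW

end Recession

/-! ### Growth at infinity and coercivity -/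

section Growth

variable {E : Type*} [NormedAddCommGroup E]

theorem eventually_norm_atTop_inf_principal_iff {V : Set E} {p : E → Prop} :
    (∀ᶠ x in comap (fun x : E => ‖x‖) atTop ⊓ 𝓟 V, p x) ↔ ∃ R : ℝ, ∀ x ∈ V, R ≤ ‖x‖ → p x := by
  rw [eventually_inf_principal, eventually_comap, eventually_atTop]
  exact ⟨fun ⟨R, h⟩ => ⟨R, fun x hx hR => h _ hR x rfl hx⟩,
    fun ⟨R, h⟩ => ⟨R, fun r hr x hxr hx => h x hx (hxr ▸ hr)⟩⟩

/-- For bounded `V` both sides hold: the filter is trivial and the lower limit is `⊤`. -/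
theorem growthAtInfinity_pos_iff {g : E → ℝ} {V : Set E} :
    0 < growthAtInfinity g V ↔ ∃ c, 0 < c ∧ ∃ R, ∀ x ∈ V, R ≤ ‖x‖ → c * ‖x‖ ≤ g x := by
  constructor
  · intro h
    obtain ⟨c, hc0, hc⟩ := EReal.lt_iff_exists_real_btwn.1 h
    obtain ⟨R, hR⟩ := eventually_norm_atTop_inf_principal_iff.1 (eventually_lt_of_lt_liminf hc)
    refine ⟨c, by exact_mod_cast hc0, max R 1, fun x hx hxR => ?_⟩
    have h1 := EReal.coe_lt_coe_iff.1 (hR x hx ((le_max_left _ _).trans hxR))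
    have h2 : 0 < ‖x‖ := one_pos.trans_le ((le_max_right _ _).trans hxR)
    exact ((lt_div_iff₀ h2).1 h1).le
  · rintro ⟨c, hc, R, hR⟩
    refine lt_of_lt_of_le (EReal.coe_pos.2 hc) (le_liminf_of_le (h := ?_))
    refine eventually_norm_atTop_inf_principal_iff.2 ⟨max R 1, fun x hx hxR => ?_⟩
    have h2 : 0 < ‖x‖ := one_pos.trans_le ((le_max_right _ _).trans hxR)
    exact EReal.coe_le_coe_iff.2
      ((le_div_iff₀ h2).2 (hR x hx ((le_max_left _ _).trans hxR)))

theorem isCoerciveOn_of_linear_growth {g : E → ℝ} {V : Set E} {c R : ℝ} (hc : 0 < c)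
    (h : ∀ x ∈ V, R ≤ ‖x‖ → c * ‖x‖ ≤ g x) : IsCoerciveOn g V := by
  intro u hu hnorm
  refine tendsto_atTop_mono' _ ?_ (hnorm.const_mul_atTop hc)
  filter_upwards [hnorm.eventually_ge_atTop R] with k hk using h _ (hu k) hk

theorem IsCoerciveOn.exists_forall_ge {g : E → ℝ} {V : Set E} (h : IsCoerciveOn g V) (M : ℝ) :
    ∃ R : ℝ, ∀ x ∈ V, R ≤ ‖x‖ → M ≤ g x := by
  by_contra! hcon
  choose u hu hnorm hlt using fun k : ℕ => hcon k
  obtain ⟨k, hk⟩ := ((h u hu (tendsto_atTop_mono hnorm tendsto_natCast_atTop_atTop)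
    ).eventually_ge_atTop M).exists
  exact (hlt k).not_ge hk

end Growth

/-! ### Sufficient and necessary conditions for the error bound -/

section ErrorBounds

variable {E : Type*} [NormedAddCommGroup E] [NormedSpace ℝ E] [FiniteDimensional ℝ E]
  {H : Type*} [NormedAddCommGroup H] [NormedSpace ℝ H] {n : ℕ}
  {F : E → H} {G : E → Fin n → ℝ} {V : Set E}

/-- On a piece containing `y`, Hoffman's bound with zero right side puts `x` within a fixed distance
of a recession direction `z`. The residual is convex along the segment from `y` to `y + z`, and the
Lipschitz property transfers this to `x`. -/
theorem exists_systemResidual_smul_le (hF : IsPiecewiseAffine F) (hG : IsPiecewiseAffine G) :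
    ∃ C : ℝ, 0 ≤ C ∧ ∀ (x : E) (t : ℝ), 0 ≤ t → t ≤ 1 →
      systemResidual F G (t • x) ≤ t * systemResidual F G x + C := by
  obtain ⟨L, hL, hlip⟩ := exists_lipschitz_systemResidual hF hG
  obtain ⟨D⟩ := exists_affineDecomposition hF hG
  suffices h : ∀ p, ∀ᶠ C : ℝ in atTop, ∀ x ∈ D.P p, ∀ t : ℝ, 0 ≤ t → t ≤ 1 →
      systemResidual F G (t • x) ≤ t * systemResidual F G x + C by
    obtain ⟨C, hC, hC0⟩ := ((eventually_all.2 h).and (eventually_ge_atTop 0)).exists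
    refine ⟨C, hC0, fun x t ht ht1 => ?_⟩
    obtain ⟨p, hp⟩ := D.cover x
    exact hC p x hp t ht ht1
  intro p
  rcases (D.P p).eq_empty_or_nonempty with he | ⟨y, hy⟩
  · simp [he]
  obtain ⟨m, a, b, hab⟩ := D.isPolyhedral p
  rcases hoffmanAlternative a 0 with ⟨K, hK, h⟩ | ⟨ε, hε, h⟩
  swap
  · exact absurd (h 0 0 le_rfl (by simp)) (not_le.2 hε)
  set M := K * ∑ i, |b i| with hM
  have hM0 : 0 ≤ ∑ i, |b i| := Finset.sum_nonneg fun _ _ => abs_nonneg _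
  -- One `φ(y)` comes from convexity; the two Lipschitz errors come from replacing `t • x` by `y + t
  -- • z` and `y + z` by `x`.
  filter_upwards [eventually_ge_atTop (systemResidual F G y + 2 * (L * (M + ‖y‖)))]
    with C hC x hx t ht ht1
  obtain ⟨z, hz, hxz⟩ := h x _ hM0 fun i => by
    have hx' := hx
    rw [hab] at hx'
    have := Finset.single_le_sum (f := fun i => |b i|) (fun i _ => abs_nonneg _)
      (Finset.mem_univ i)
    simp only [Pi.zero_apply, zero_add]
    linarith [hx' i, le_abs_self (b i)]
  have hray : ∀ s : ℝ, 0 ≤ s → y + s • z ∈ D.P p := by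
    intro s hs
    rw [hab] at hy ⊢
    intro i
    rw [map_add, map_smul, smul_eq_mul]
    linarith [hy i, mul_nonpos_of_nonneg_of_nonpos hs (hz i)]
  have hyz : y + z ∈ D.P p := by simpa using hray 1 zero_le_one
  have h1 : systemResidual F G (t • x) ≤ systemResidual F G (y + t • z) + L * (M + ‖y‖) := by
    refine (hlip _ (y + t • z)).trans (add_le_add le_rfl (mul_le_mul_of_nonneg_left ?_ hL))
    calc ‖t • x - (y + t • z)‖ = ‖t • (x - z) - y‖ := by rw [smul_sub]; congr 1; abel
      _ ≤ t * ‖x - z‖ + ‖y‖ := (norm_sub_le _ _).trans (by rw [norm_smul_of_nonneg ht])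
      _ ≤ M + ‖y‖ := by
        linarith [mul_le_of_le_one_left (norm_nonneg (x - z)) ht1]
  have h2 : systemResidual F G (y + z) ≤ systemResidual F G x + L * (M + ‖y‖) := by
    refine (hlip _ x).trans (add_le_add le_rfl (mul_le_mul_of_nonneg_left ?_ hL))
    calc ‖y + z - x‖ = ‖y - (x - z)‖ := by congr 1; abel
      _ ≤ ‖y‖ + ‖x - z‖ := norm_sub_le _ _
      _ ≤ M + ‖y‖ := by linarith
  have h3 : systemResidual F G (y + t • z) ≤
      (1 - t) * systemResidual F G y + t * systemResidual F G (y + z) := by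
    rw [D.systemResidual_eq (hray t ht), D.systemResidual_eq hy, D.systemResidual_eq hyz]
    have := (convexOn_systemResidual (D.A p) (D.B p)).2 (Set.mem_univ y) (Set.mem_univ (y + z))
      (sub_nonneg.2 ht1) ht (sub_add_cancel 1 t)
    have e : (1 - t) • y + t • (y + z) = y + t • z := by
      rw [sub_smul, one_smul, smul_add]; abel
    rwa [e] at this
  have h4 := mul_le_mul_of_nonneg_left h2 ht
  have h5 := mul_le_of_le_one_left (systemResidual_nonneg F G y) (sub_le_self 1 ht)
  have h6 : t * (L * (M + ‖y‖)) ≤ L * (M + ‖y‖) :=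
    mul_le_of_le_one_left (by positivity) ht1
  linarith

variable [FiniteDimensional ℝ H]

/-- Near its zero set the residual bounds the distance to the solution set. -/
theorem eventually_infDist_le (hF : IsPiecewiseAffine F) (hG : IsPiecewiseAffine G) :
    ∀ᶠ K : ℝ in atTop, ∀ x, K * systemResidual F G x < 1 →
      Metric.infDist x (solutionSet F G) ≤ K * systemResidual F G x := by
  obtain ⟨D⟩ := exists_affineDecomposition hF hG
  suffices h : ∀ p, ∀ᶠ K : ℝ in atTop, ∀ x ∈ D.P p, K * systemResidual F G x < 1 →
      Metric.infDist x (solutionSet F G) ≤ K * systemResidual F G x by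
    filter_upwards [eventually_all.2 h] with K hK x
    obtain ⟨p, hp⟩ := D.cover x
    exact hK p x hp
  intro p
  obtain ⟨m, a, b, hab⟩ := D.isPolyhedral p
  have hviol : ∀ x ∈ D.P p, (∀ i, a i x ≤ b i + systemResidual F G x) ∧
      ‖D.A p x‖ ≤ systemResidual F G x ∧ ∀ j, D.B p x j ≤ systemResidual F G x := by
    intro x hx
    refine ⟨fun i => ?_, ?_, fun j => ?_⟩
    · have hx' := hx
      rw [hab] at hx'
      linarith [hx' i, systemResidual_nonneg F G x]
    · rw [← D.eq_A p x hx]; exact norm_le_systemResidual F G x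
    · rw [← D.eq_B p x hx]; exact le_systemResidual F G x j
  rcases hoffmanAlternative_affine a b (D.A p) (D.B p) with ⟨C, hC, h⟩ | ⟨ε, hε, h⟩
  · filter_upwards [eventually_ge_atTop C] with K hK x hx _
    obtain ⟨h1, h2, h3⟩ := hviol x hx
    obtain ⟨y, hy, hAy, hBy, hxy⟩ := h x _ (systemResidual_nonneg F G x) h1 h2 h3
    have hyΩ : y ∈ solutionSet F G :=
      D.mem_solutionSet_iff.2 ⟨p, by rw [hab]; exact hy, hAy, hBy⟩
    refine (Metric.infDist_le_dist_of_mem hyΩ).trans ?_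
    rw [dist_eq_norm]
    exact hxy.trans (mul_le_mul_of_nonneg_right hK (systemResidual_nonneg F G x))
  · filter_upwards [eventually_ge_atTop ε⁻¹] with K hK x hx hlt
    obtain ⟨h1, h2, h3⟩ := hviol x hx
    have := h x _ (systemResidual_nonneg F G x) h1 h2 h3
    have h4 : ε⁻¹ * ε ≤ K * systemResidual F G x :=
      mul_le_mul hK this hε.le ((inv_nonneg.2 hε.le).trans hK)
    rw [inv_mul_cancel₀ hε.ne'] at h4
    linarith

/-- Where `K φ < 1` the local bound applies; elsewhere `1 ≤ K φ`, so `C (1 + φ) ≤ C (K + 1) φ`. -/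
theorem hasErrorBoundOn_of_infDist_le (hF : IsPiecewiseAffine F) (hG : IsPiecewiseAffine G)
    {C : ℝ} (hC : 0 ≤ C) (h : ∀ x ∈ V, Metric.infDist x (solutionSet F G) ≤
      C * (1 + systemResidual F G x)) : HasErrorBoundOn F G V := by
  obtain ⟨K, hK, hK0⟩ := ((eventually_infDist_le hF hG).and (eventually_gt_atTop 0)).exists
  have hpos : 0 < K + C * (K + 1) := by positivity
  refine ⟨(K + C * (K + 1))⁻¹, by positivity, fun x hx => ?_⟩
  rw [inv_mul_le_iff₀ hpos]
  have h0 := systemResidual_nonneg F G x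
  rcases lt_or_ge (K * systemResidual F G x) 1 with hlt | hge
  · have h1 := hK x hlt
    have h2 : 0 ≤ C * (K + 1) * systemResidual F G x := by positivity
    linarith
  · have h1 := mul_le_mul_of_nonneg_left hge hC
    have h2 : 0 ≤ K * systemResidual F G x := by positivity
    linarith [h x hx]

theorem hasErrorBoundOn_of_linear_growth (hF : IsPiecewiseAffine F) (hG : IsPiecewiseAffine G)
    (hΩ : (solutionSet F G).Nonempty) {c R : ℝ} (hc : 0 < c)
    (h : ∀ x ∈ V, R ≤ ‖x‖ → c * ‖x‖ ≤ systemResidual F G x) : HasErrorBoundOn F G V := by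
  obtain ⟨w, hw⟩ := hΩ
  refine hasErrorBoundOn_of_infDist_le hF hG (C := |R| + ‖w‖ + c⁻¹) (by positivity) fun x hx => ?_
  have h0 := systemResidual_nonneg F G x
  have h1 : Metric.infDist x (solutionSet F G) ≤ ‖x‖ + ‖w‖ :=
    (Metric.infDist_le_dist_of_mem hw).trans (by rw [dist_eq_norm]; exact norm_sub_le _ _)
  have h2 : ‖x‖ ≤ |R| + c⁻¹ * systemResidual F G x := by
    rcases lt_or_ge ‖x‖ R with hR | hR
    · have : 0 ≤ c⁻¹ * systemResidual F G x := by positivity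
      linarith [le_abs_self R]
    · have := (le_inv_mul_iff₀ hc).2 (h x hx hR)
      linarith [abs_nonneg R]
  have h3 : 0 ≤ (|R| + ‖w‖) * systemResidual F G x := by positivity
  have h4 : 0 < c⁻¹ := by positivity
  linarith

theorem hasErrorBoundOn_of_isBounded (hF : IsPiecewiseAffine F) (hG : IsPiecewiseAffine G)
    (hΩ : (solutionSet F G).Nonempty) (hV : Bornology.IsBounded V) : HasErrorBoundOn F G V := by
  obtain ⟨R, hR⟩ := hV.exists_norm_le
  refine hasErrorBoundOn_of_linear_growth hF hG hΩ (R := R + 1) one_pos fun x hx hxR => ?_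
  linarith [hR x hx]

theorem hasErrorBoundOn_of_isCone (hF : IsPiecewiseAffine F) (hG : IsPiecewiseAffine G)
    (hΩ : (solutionSet F G).Nonempty) (hV : IsCone V)
    (hco : IsCoerciveOn (systemResidual F G) V) : HasErrorBoundOn F G V := by
  obtain ⟨C, hC, hle⟩ := exists_systemResidual_smul_le hF hG
  -- The level `C + 1` beats the additive error `C`: rescaling `x` to norm `S` leaves `1 ≤ (S / ‖x‖)
  -- φ(x)`.
  obtain ⟨R, hR⟩ := hco.exists_forall_ge (C + 1)
  set S := max R 1 with hS
  have hS0 : 0 < S := one_pos.trans_le (le_max_right _ _)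
  refine hasErrorBoundOn_of_linear_growth hF hG hΩ (inv_pos.2 hS0) (R := S) fun x hx hxS => ?_
  have hx0 : 0 < ‖x‖ := hS0.trans_le hxS
  have ht : 0 < S / ‖x‖ := div_pos hS0 hx0
  have h1 := hR _ (hV x hx _ ht) (by
    rw [norm_smul_of_nonneg ht.le, div_mul_cancel₀ _ hx0.ne']; exact le_max_left _ _)
  have h2 := hle x _ ht.le ((div_le_one hx0).2 hxS)
  have h3 : 1 ≤ S / ‖x‖ * systemResidual F G x := by linarith
  rw [inv_mul_le_iff₀ hS0]
  rwa [div_mul_eq_mul_div, le_div_iff₀ hx0, one_mul] at h3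

theorem hasErrorBoundOn_univ_of_isPosHomogeneous (hF : IsPiecewiseAffine F)
    (hG : IsPiecewiseAffine G) (hΩ : (solutionSet F G).Nonempty) (hF' : IsPosHomogeneous F)
    (hG' : IsPosHomogeneous G) : HasErrorBoundOn F G Set.univ := by
  obtain ⟨τ, hτ, h⟩ := hasErrorBoundOn_of_isBounded hF hG hΩ
    (Metric.isBounded_closedBall (x := (0 : E)) (r := 1))
  refine ⟨τ, hτ, fun x _ => ?_⟩
  have hs : 0 < 1 + ‖x‖ := by positivity
  -- This factor brings `x` into the unit ball and needs no separate case `x = 0`.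
  set t := (1 + ‖x‖)⁻¹ with ht
  have ht0 : 0 < t := inv_pos.2 hs
  have h1 := h (t • x) (by
    rw [mem_closedBall_zero_iff, norm_smul_of_nonneg ht0.le, ht, inv_mul_le_iff₀ hs]
    linarith)
  have h2 : systemResidual F G (t • x) = t * systemResidual F G x := by
    simp only [systemResidual, hF' x t ht0, hG' x t ht0, norm_smul_of_nonneg ht0.le, mul_add,
      Finset.mul_sum, Pi.smul_apply, smul_eq_mul, mul_max_of_nonneg _ _ ht0.le, mul_zero]
  have h3 : t * Metric.infDist x (solutionSet F G) ≤
      Metric.infDist (t • x) (solutionSet F G) := by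
    refine (Metric.le_infDist hΩ).2 fun w hw => ?_
    have hi : 0 < t⁻¹ := inv_pos.2 ht0
    have hw' : t⁻¹ • w ∈ solutionSet F G := by
      refine ⟨by rw [hF' _ _ hi, hw.1, smul_zero], fun i => ?_⟩
      rw [hG' _ _ hi, Pi.smul_apply, smul_eq_mul]
      exact mul_nonpos_of_nonneg_of_nonpos hi.le (hw.2 i)
    have h4 := mul_le_mul_of_nonneg_left (Metric.infDist_le_dist_of_mem (x := x) hw') ht0.le
    refine h4.trans_eq ?_
    rw [dist_eq_norm, dist_eq_norm, ← norm_smul_of_nonneg ht0.le, smul_sub,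
      smul_inv_smul₀ ht0.ne']
  rw [h2] at h1
  have h5 := mul_le_mul_of_nonneg_left h3 hτ.le
  refine le_of_mul_le_mul_left ?_ ht0
  linarith

theorem hasErrorBoundOn_of_recessionCone_subset (hF : IsPiecewiseAffine F)
    (hG : IsPiecewiseAffine G) (hV : IsFiniteUnionPolyhedral V)
    (hrec : lowerLevelSet (recessionFunction (systemResidual F G)) ∩ recessionCone V ⊆
      recessionCone (solutionSet F G)) : HasErrorBoundOn F G V := by
  obtain ⟨N, Q, hQ, hVQ⟩ := hV
  obtain ⟨D⟩ := exists_affineDecomposition hF hG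
  obtain ⟨W, hW0, hW⟩ := exists_infDist_recessionCone_le hF hG
  suffices h : ∀ k p, ∀ᶠ C : ℝ in atTop, ∀ x ∈ Q k ∩ D.P p,
      Metric.infDist x (solutionSet F G) ≤ C * (1 + systemResidual F G x) by
    obtain ⟨C, hC, hC0⟩ := ((eventually_all.2 fun k => eventually_all.2 (h k)).and
      (eventually_ge_atTop 0)).exists
    refine hasErrorBoundOn_of_infDist_le hF hG hC0 fun x hx => ?_
    rw [hVQ] at hx
    obtain ⟨k, hk⟩ := Set.mem_iUnion.1 hx
    obtain ⟨p, hp⟩ := D.cover x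
    exact hC k p x ⟨hk, hp⟩
  intro k p
  rcases (Q k ∩ D.P p).eq_empty_or_nonempty with he | ⟨y, hy⟩
  · simp [he]
  obtain ⟨m, a, b, hab⟩ := (hQ k).inter (D.isPolyhedral p)
  -- Solutions of the homogenised system recede in `Q k ∩ D.P p`, hence in `V`, and have `φ^∞ ≤ 0`.
  have hK : ∀ z, (∀ i, a i z ≤ 0) → (D.A p).linear z = 0 → (∀ j, (D.B p).linear z j ≤ 0) →
      z ∈ recessionCone (solutionSet F G) := by
    intro z hz hAz hBz
    have hray : ∀ t : ℝ, 0 ≤ t → y + t • z ∈ Q k ∩ D.P p := by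
      intro t ht
      rw [hab] at hy ⊢
      intro i
      rw [map_add, map_smul, smul_eq_mul]
      linarith [hy i, mul_nonpos_of_nonneg_of_nonpos ht (hz i)]
    refine hrec ⟨?_, y, ?_, fun t ht => ?_⟩
    · rw [lowerLevelSet, Set.mem_ofPred_eq,
        D.recessionFunction_eq hF hG fun t ht => (hray t ht).2]
      exact systemResidual_le_zero_iff.2 ⟨hAz, hBz⟩
    · rw [hVQ]; exact Set.mem_iUnion.2 ⟨k, hy.1⟩
    · rw [hVQ]; exact Set.mem_iUnion.2 ⟨k, (hray t ht).1⟩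
  rcases hoffmanAlternative_affine a 0 (D.A p).linear.toAffineMap (D.B p).linear.toAffineMap
    with ⟨C₀, hC₀, h⟩ | ⟨ε, hε, h⟩
  swap
  · exact absurd (h 0 0 le_rfl (by simp) (by simp) (by simp)) (not_le.2 hε)
  have hb0 : 0 ≤ ∑ i, |b i| := Finset.sum_nonneg fun _ _ => abs_nonneg _
  -- Dropping the constant terms of the system costs at most `M`, so `x` violates the homogenised
  -- system by at most `M + φ(x)`.
  set M := ∑ i, |b i| + ‖D.A p 0‖ + ‖D.B p 0‖ with hM
  have hM0 : 0 ≤ M := by positivity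
  filter_upwards [eventually_ge_atTop (W + C₀ * M + C₀)] with C hC x hx
  have hφ := systemResidual_nonneg F G x
  obtain ⟨z, hz, hAz, hBz, hxz⟩ := h x (M + systemResidual F G x) (by positivity)
    (fun i => by
      have hx' := hx
      rw [hab] at hx'
      have := Finset.single_le_sum (f := fun i => |b i|) (fun i _ => abs_nonneg _)
        (Finset.mem_univ i)
      simp only [Pi.zero_apply, zero_add]
      linarith [hx' i, le_abs_self (b i), norm_nonneg (D.A p 0), norm_nonneg (D.B p 0)])
    (by
      have h1 : (D.A p).linear x = F x - D.A p 0 := by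
        rw [D.eq_A p x hx.2, affineMap_apply_eq (D.A p) x, add_sub_cancel_right]
      rw [LinearMap.coe_toAffineMap, h1]
      linarith [norm_sub_le (F x) (D.A p 0), norm_le_systemResidual F G x,
        norm_nonneg (D.B p 0)])
    (fun j => by
      have h1 : (D.B p).linear x = G x - D.B p 0 := by
        rw [D.eq_B p x hx.2, affineMap_apply_eq (D.B p) x, add_sub_cancel_right]
      rw [LinearMap.coe_toAffineMap, h1, Pi.sub_apply]
      have h2 := norm_le_pi_norm (D.B p 0) j
      rw [Real.norm_eq_abs] at h2
      linarith [neg_le_of_abs_le h2, le_systemResidual F G x j, norm_nonneg (D.A p 0)])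
  have h1 := hW z (hK z hz hAz hBz)
  have h2 := Metric.infDist_le_infDist_add_dist (x := x) (y := z) (s := solutionSet F G)
  rw [dist_eq_norm] at h2
  have h3 : (W + C₀ * M + C₀) * (1 + systemResidual F G x) ≤ C * (1 + systemResidual F G x) :=
    mul_le_mul_of_nonneg_right hC (by positivity)
  have h4 : 0 ≤ (W + C₀ * M) * systemResidual F G x := by positivity
  linarith

theorem HasErrorBoundOn.recessionCone_subset (hF : IsPiecewiseAffine F)
    (hG : IsPiecewiseAffine G) (hΩ : (solutionSet F G).Nonempty) (h : HasErrorBoundOn F G V) :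
    lowerLevelSet (recessionFunction (systemResidual F G)) ∩ recessionCone V ⊆
      recessionCone (solutionSet F G) := by
  obtain ⟨τ, hτ, h⟩ := h
  rintro z ⟨hz, x, -, hxV⟩
  obtain ⟨D⟩ := exists_affineDecomposition hF hG
  obtain ⟨p, ⟨s, hs, hsp⟩, hrec⟩ := exists_recession_of_ray D.isPolyhedral (x := x) (z := z)
    fun t _ => D.cover _
  have hray := fun t ht => hrec _ hsp t ht
  rw [lowerLevelSet, Set.mem_ofPred_eq, D.recessionFunction_eq hF hG hray,
    systemResidual_le_zero_iff] at hz
  set y := x + s • z with hy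
  -- From the entry point `y` on, the ray stays in one piece; there the linear part of `F` kills `z`
  -- and that of `G` is nonpositive at `z`.
  have hφ : ∀ t : ℝ, 0 ≤ t → systemResidual F G (y + t • z) ≤ systemResidual F G y := by
    intro t ht
    rw [D.systemResidual_eq (hray t ht), D.systemResidual_eq hsp, systemResidual, systemResidual,
      affineMap_apply_eq (D.A p) (y + t • z), affineMap_apply_eq (D.A p) y,
      affineMap_apply_eq (D.B p) (y + t • z), affineMap_apply_eq (D.B p) y,
      map_add (D.A p).linear y (t • z), map_add (D.B p).linear y (t • z), map_smul, map_smul, hz.1]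
    refine add_le_add (by simp) (Finset.sum_le_sum fun j _ => max_le_max ?_ le_rfl)
    simp only [Pi.add_apply, Pi.smul_apply, smul_eq_mul]
    linarith [mul_nonpos_of_nonneg_of_nonpos ht (hz.2 j)]
  have hdist : ∀ k : ℕ, Metric.infDist (y + (k : ℝ) • z) (solutionSet F G) ≤
      τ⁻¹ * systemResidual F G y := by
    intro k
    rw [le_inv_mul_iff₀ hτ]
    refine (h _ ?_).trans (hφ k k.cast_nonneg)
    have := hxV (s + k) (by positivity)
    rwa [add_smul, ← add_assoc] at this
  refine mem_recessionCone_solutionSet_of_tendsto hF hG hΩ tendsto_natCast_atTop_atTop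
    (tendsto_inv_smul_ray y z) ?_
  have hlim : Tendsto (fun k : ℕ => (k : ℝ)⁻¹ * (τ⁻¹ * systemResidual F G y)) atTop (𝓝 0) := by
    simpa using ((tendsto_inv_atTop_zero (𝕜 := ℝ)).comp
      tendsto_natCast_atTop_atTop).mul_const (τ⁻¹ * systemResidual F G y)
  exact squeeze_zero (fun k => mul_nonneg (by positivity) Metric.infDist_nonneg)
    (fun k => mul_le_mul_of_nonneg_left (hdist k) (by positivity)) hlim

theorem HasErrorBoundOn.exists_linear_growth (hF : IsPiecewiseAffine F)
    (hG : IsPiecewiseAffine G) (hΩ : (solutionSet F G).Nonempty) (h : HasErrorBoundOn F G V)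
    (hcone : recessionCone (solutionSet F G) ∩ closure (conicHull V) ⊆ {0}) :
    ∃ c, 0 < c ∧ ∃ R, ∀ x ∈ V, R ≤ ‖x‖ → c * ‖x‖ ≤ systemResidual F G x := by
  obtain ⟨τ, hτ, h⟩ := h
  by_contra! hcon
  -- Failure for `c = 1 / (k + 1)` and `R = k + 1` gives `‖x k‖ → ∞` with `φ(x k) / ‖x k‖ → 0`.
  choose x hxV hxk hlt using fun k : ℕ => hcon ((k : ℝ) + 1)⁻¹ (by positivity) (k + 1)
  have hpos : ∀ k, 0 < ‖x k‖ := fun k => (by positivity : (0 : ℝ) < k + 1).trans_le (hxk k)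
  have hnorm : Tendsto (fun k => ‖x k‖) atTop atTop :=
    tendsto_atTop_mono (fun k => (le_add_of_nonneg_right zero_le_one).trans (hxk k))
      tendsto_natCast_atTop_atTop
  obtain ⟨u, hu, ψ, hψ, hlim⟩ := (isCompact_sphere (0 : E) 1).tendsto_subseq
    (x := fun k => ‖x k‖⁻¹ • x k) fun k => by
      rw [mem_sphere_zero_iff_norm, norm_smul_of_nonneg (by positivity),
        inv_mul_cancel₀ (hpos k).ne']
  have hsub := hψ.tendsto_atTop
  have hbound : ∀ k, ‖x k‖⁻¹ * Metric.infDist (x k) (solutionSet F G) ≤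
      τ⁻¹ * ((k : ℝ) + 1)⁻¹ := by
    intro k
    rw [inv_mul_le_iff₀ (hpos k)]
    have h1 := (le_inv_mul_iff₀ hτ).2 ((h _ (hxV k)).trans (hlt k).le)
    linarith
  have hzero : Tendsto (fun k => ‖x k‖⁻¹ * Metric.infDist (x k) (solutionSet F G)) atTop
      (𝓝 0) := by
    refine squeeze_zero (fun k => mul_nonneg (by positivity) Metric.infDist_nonneg) hbound ?_
    have := (tendsto_one_div_add_atTop_nhds_zero_nat (𝕜 := ℝ)).const_mul τ⁻¹
    simpa using this
  have h1 := mem_recessionCone_solutionSet_of_tendsto hF hG hΩ (hnorm.comp hsub) hlim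
    (hzero.comp hsub)
  have h2 : u ∈ closure (conicHull V) := mem_closure_of_tendsto hlim
    (Eventually.of_forall fun k => ⟨_, hxV (ψ k), _, inv_pos.2 (hpos (ψ k)), rfl⟩)
  have h3 : u = 0 := hcone ⟨h1, h2⟩
  rw [h3] at hu
  simp at hu

end ErrorBounds

end PAErrorBound

theorem mainTheorem10
    {E : Type*} [NormedAddCommGroup E] [NormedSpace ℝ E] [FiniteDimensional ℝ E]
    {H : Type*} [NormedAddCommGroup H] [NormedSpace ℝ H] [FiniteDimensional ℝ H]
    {n : ℕ} (F : E → H) (G : E → Fin n → ℝ)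
    (hF : IsPiecewiseAffine F) (hG : IsPiecewiseAffine G)
    (hΩ : (solutionSet F G).Nonempty) (V : Set E) :
    -- the limits defining the recession function of the residual exist
    (∀ x : E, Tendsto (fun t : ℝ => systemResidual F G (t • x) / t) atTop
        (𝓝 (recessionFunction (systemResidual F G) x))) ∧
    -- sufficiency of each of the five conditions
    ((Bornology.IsBounded V ∨
      (¬ Bornology.IsBounded V ∧ 0 < growthAtInfinity (systemResidual F G) V) ∨
      (IsCone V ∧ IsCoerciveOn (systemResidual F G) V) ∨
      (V = Set.univ ∧ IsPosHomogeneous F ∧ IsPosHomogeneous G) ∨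
      (IsFiniteUnionPolyhedral V ∧
        lowerLevelSet (recessionFunction (systemResidual F G)) ∩ recessionCone V ⊆
          recessionCone (solutionSet F G))) →
      HasErrorBoundOn F G V) ∧
    -- necessity of the recession inclusion, for arbitrary `V`
    (HasErrorBoundOn F G V →
      lowerLevelSet (recessionFunction (systemResidual F G)) ∩ recessionCone V ⊆
        recessionCone (solutionSet F G)) ∧
    -- necessity of the growth and coercivity conditions
    (recessionCone (solutionSet F G) ∩ closure (conicHull V) = {0} →
      HasErrorBoundOn F G V →
      (¬ Bornology.IsBounded V → 0 < growthAtInfinity (systemResidual F G) V) ∧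
        IsCoerciveOn (systemResidual F G) V) := by
  refine ⟨tendsto_recessionFunction hF hG, ?_, fun h => h.recessionCone_subset hF hG hΩ, ?_⟩
  · rintro (hV | ⟨-, hV⟩ | ⟨hV, hco⟩ | ⟨rfl, hF', hG'⟩ | ⟨hV, hrec⟩)
    · exact hasErrorBoundOn_of_isBounded hF hG hΩ hV
    · obtain ⟨c, hc, R, hR⟩ := growthAtInfinity_pos_iff.1 hV
      exact hasErrorBoundOn_of_linear_growth hF hG hΩ hc hR
    · exact hasErrorBoundOn_of_isCone hF hG hΩ hV hco
    · exact hasErrorBoundOn_univ_of_isPosHomogeneous hF hG hΩ hF' hG'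
    · exact hasErrorBoundOn_of_recessionCone_subset hF hG hV hrec
  · intro hcone h
    obtain ⟨c, hc, R, hR⟩ := h.exists_linear_growth hF hG hΩ hcone.subset
    exact ⟨fun _ => growthAtInfinity_pos_iff.2 ⟨c, hc, R, hR⟩,
      isCoerciveOn_of_linear_growth hc hR⟩
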